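/- Let $A$ be a $C^*$-algebra, $X$ a (right) Hilbert $C^*$-module over $A$, $\mathcal H,\mathcal K$ Hilbert spaces, $\varphi:A\to L(\mathcal H)$ a completely positive linear map, and $\Phi:X\to L(\mathcal H,\mathcal K)$ a $\varphi$-map, i.e. $\Phi(x)^*\Phi(y)=\varphi(\langle x,y\rangle)$ for all $x,y\in X$. Let $K(X)$ be the $C^*$-algebra of `compact' operators on $X$, the norm closed linear span of the operators $\theta_{x,y}:z\mapsto x\langle y,z\rangle$. Put $$M_\varphi=\{a\in A:\varphi(ab)=\varphi(a)\varphi(b),\ \varphi(ba)=\varphi(b)\varphi(a)\ \forall b\in A\},$$ $$T_\varphi=\{a\in M_\varphi:\varphi(ba^*c)=\varphi(b)\varphi(a)^*\varphi(c)\ \forall b,c\in A\},\qquad X_\varphi=\{x\in X:\Phi(xb)=\Phi(x)\varphi(b)\ \forall b\in A\}.$$ A minimal Stinespring representation associated to $(\varphi,\Phi)$ consists of Hilbert spaces $\mathcal H',\mathcal K'$, a $*$-representation $\pi:A\to L(\mathcal H')$, a map $\Pi:X\to L(\mathcal H',\mathcal K')$ with $\Pi(x)^*\Pi(y)=\pi(\langle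 x,y\rangle)$ for all $x,y\in X$, a bounded operator $V:\mathcal H\to\mathcal H'$ and a coisometry $W:\mathcal K\to\mathcal K'$ such that $\varphi(a)=V^*\pi(a)V$ for all $a\in A$, $\Phi(x)=W^*\Pi(x)V$ for all $x\in X$, and the linear spans of $\pi(A)V\mathcal H$ and of $\Pi(X)V\mathcal H$ are dense in $\mathcal H'$ and $\mathcal K'$ respectively. The induced representation $\phi_{\Phi,\varphi}:K(X)\to L(\mathcal K)$ is $\phi_{\Phi,\varphi}(T)=W^*\Gamma(T)W$, where $\Gamma:K(X)\to L(\mathcal K')$ is the $*$-representation with $\Gamma(\theta_{x,y})=\Pi(x)\Pi(y)^*$ for all $x,y\in X$. Then $X_\varphi$ does not depend on the choice of the $\varphi$-map $\Phi$; there is exactly one $*$-representation $\phi_{\Phi,\varphi}$ of $K(X)$ on $\mathcal K$ that arises in this way from a minimal Stinespring representation associated to $(\varphi,\Phi)$; and the following hold. 1. $\Phi(Tz)=\phi_{\Phi,\varphi}(T)\Phi(z)$ for all $T\in K(X)$ and $z\in X$. 2. $K(X)X_\varphi\subseteq X_\varphi$. 3. If $\varphi$ is contractive, then for every $x\in X$: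 $x\in X_\varphi$ if and only if $\phi_{\Phi,\varphi}(\theta_{x,x})=\Phi(x)\Phi(x)^*$. 4. If $\varphi$ is contractive, then for every $x\in X$: $x\in X_\varphi$ if and only if $\phi_{\Phi,\varphi}(\theta_{x,y})=\Phi(x)\Phi(y)^*$ for all $y\in X$. 5. $\phi_{\Phi,\varphi}(\theta_{xa,y})=\Phi(xa)\Phi(y)^*=\Phi(x)\varphi(a)\Phi(y)^*$ for all $x,y\in X$ and $a\in T_\varphi$. -/

import Mathlib

open scoped RightActions

set_option linter.unusedSectionVars false

/-! ### Hilbert C⋆-modules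

A (right) Hilbert module over the C⋆-algebra `A` is a Banach space `X` with
`[SMul Aᵐᵒᵖ X] [CStarModule Aᵐᵒᵖ X]`; the right action is `x <• a = MulOpposite.op a • x`.
Mathlib's `CStarModule` uses left actions, so the right modules over `A` are its modules over `Aᵐᵒᵖ`;
reading the inner product in `A` (`HilbertModule.rinner`) gives the usual identities, linear and
`A`-linear in the second variable. -/

namespace HilbertModule

section Basic

variable (A : Type*) {X : Type*} [NonUnitalCStarAlgebra A] [PartialOrder A]
  [NormedAddCommGroup X] [NormedSpace ℂ X] [SMul Aᵐᵒᵖ X] [CStarModule Aᵐᵒᵖ X]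

/-- The `A`-valued inner product `⟨x, y⟩`. -/
def rinner (x y : X) : A := MulOpposite.unop (inner Aᵐᵒᵖ x y)

variable {A}

theorem rinner_smul_right (x y : X) (a : A) : rinner A x (y <• a) = rinner A x y * a := by
  simp [rinner]

theorem star_rinner (x y : X) : star (rinner A x y) = rinner A y x := by
  rw [rinner, rinner, ← MulOpposite.unop_star, CStarModule.star_inner]

theorem rinner_self_nonneg (x : X) : 0 ≤ rinner A x x :=
  CStarModule.inner_self_nonneg (A := Aᵐᵒᵖ) (x := x)

theorem norm_sq_eq_rinner (x : X) : ‖x‖ ^ 2 = ‖rinner A x x‖ :=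
  CStarModule.norm_sq_eq Aᵐᵒᵖ

theorem rinner_add_right (x y z : X) : rinner A x (y + z) = rinner A x y + rinner A x z := by
  simp [rinner]

theorem rinner_complex_smul_right (c : ℂ) (x y : X) :
    rinner A x (c • y) = c • rinner A x y := by
  simp [rinner]

theorem rinner_add_left (x y z : X) : rinner A (x + y) z = rinner A x z + rinner A y z := by
  simp [rinner]

theorem rinner_complex_smul_left (c : ℂ) (x y : X) :
    rinner A (c • x) y = star c • rinner A x y := by
  simp [rinner]

theorem rinner_sub_right (x y z : X) : rinner A x (y - z) = rinner A x y - rinner A x z := by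
  simp [rinner]

theorem rinner_sub_left (x y z : X) : rinner A (x - y) z = rinner A x z - rinner A y z := by
  simp [rinner]

theorem rinner_smul_left (x y : X) (a : A) : rinner A (x <• a) y = star a * rinner A x y := by
  rw [← star_rinner, rinner_smul_right, star_mul, star_rinner]

theorem ext_rinner {x y : X} (h : ∀ w, rinner A w x = rinner A w y) : x = y := by
  have h0 : rinner A (x - y) (x - y) = 0 := by rw [rinner_sub_right, h, sub_self]
  have h1 : ‖x - y‖ ^ 2 = 0 := by rw [norm_sq_eq_rinner (A := A), h0, norm_zero]
  exact sub_eq_zero.1 (norm_eq_zero.1 (pow_eq_zero_iff two_ne_zero |>.1 h1))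

theorem smul_smul_right (x : X) (a b : A) : (x <• a) <• b = x <• (a * b) :=
  ext_rinner (A := A) fun w => by simp only [rinner_smul_right, mul_assoc]

theorem smul_add_right (x : X) (a b : A) : x <• (a + b) = x <• a + x <• b :=
  ext_rinner (A := A) fun w => by simp only [rinner_smul_right, rinner_add_right, mul_add]

theorem smul_complex_smul_right (x : X) (c : ℂ) (a : A) : x <• (c • a) = c • (x <• a) :=
  ext_rinner (A := A) fun w => by
    simp only [rinner_smul_right, rinner_complex_smul_right, mul_smul_comm]

theorem norm_smul_right_le (x : X) (a : A) : ‖x <• a‖ ≤ ‖x‖ * ‖a‖ := by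
  refine le_of_sq_le_sq ?_ (by positivity)
  rw [norm_sq_eq_rinner (A := A), mul_pow, norm_sq_eq_rinner (A := A) x, rinner_smul_right,
    rinner_smul_left]
  calc ‖star a * rinner A x x * a‖ ≤ ‖star a‖ * ‖rinner A x x‖ * ‖a‖ :=
        (norm_mul_le _ _).trans (by gcongr; exact norm_mul_le _ _)
    _ = ‖rinner A x x‖ * ‖a‖ ^ 2 := by rw [norm_star]; ring

theorem norm_rinner_le [StarOrderedRing A] (x y : X) : ‖rinner A x y‖ ≤ ‖x‖ * ‖y‖ :=
  CStarModule.norm_inner_le (A := Aᵐᵒᵖ) X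

end Basic

section Compact

variable (A : Type*) {X : Type*} [NonUnitalCStarAlgebra A] [PartialOrder A] [StarOrderedRing A]
  [NormedAddCommGroup X] [NormedSpace ℂ X] [SMul Aᵐᵒᵖ X] [CStarModule Aᵐᵒᵖ X]

/-- The operator `θ_{x,y} : z ↦ x⟨y, z⟩`. -/
noncomputable def theta (x y : X) : X →L[ℂ] X :=
  LinearMap.mkContinuous
    { toFun := fun z => x <• rinner A y z
      map_add' := fun z w => by rw [rinner_add_right, smul_add_right]
      map_smul' := fun c z => by
        rw [rinner_complex_smul_right, smul_complex_smul_right, RingHom.id_apply] }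
    (‖x‖ * ‖y‖) fun z => by
      refine (norm_smul_right_le x _).trans ?_
      rw [mul_assoc]
      gcongr
      exact norm_rinner_le y z

@[simp]
theorem theta_apply (x y z : X) : theta A x y z = x <• rinner A y z := rfl

theorem theta_mul_theta (x y u v : X) :
    theta A x y * theta A u v = theta A (x <• rinner A y u) v := by
  ext z
  simp [rinner_smul_right, smul_smul_right]

variable (X)

/-- The linear span of the operators `θ_{x,y}`. -/
noncomputable def finiteRankOps : NonUnitalSubalgebra ℂ (X →L[ℂ] X) :=
  { Submodule.span ℂ {T : X →L[ℂ] X | ∃ x y : X, T = theta A x y} with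
    mul_mem' := by
      intro S T hS hT
      refine Submodule.span_induction₂ (p := fun S T _ _ =>
        S * T ∈ Submodule.span ℂ {T : X →L[ℂ] X | ∃ x y : X, T = theta A x y})
        ?_ ?_ ?_ ?_ ?_ ?_ ?_ hS hT
      · rintro _ _ ⟨x, y, rfl⟩ ⟨u, v, rfl⟩
        exact Submodule.subset_span ⟨_, _, theta_mul_theta A x y u v⟩
      · intro T _
        simp
      · intro T _
        simp
      · intro S S' T _ _ _ h h'
        rw [add_mul]
        exact Submodule.add_mem _ h h'
      · intro S T T' _ _ _ h h'
        rw [mul_add]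
        exact Submodule.add_mem _ h h'
      · intro c S T _ _ h
        rw [smul_mul_assoc]
        exact Submodule.smul_mem _ c h
      · intro c S T _ _ h
        rw [mul_smul_comm]
        exact Submodule.smul_mem _ c h }

/-- `K(X)`, the algebra of 'compact' operators: the norm closed linear span of the `θ_{x,y}`. -/
noncomputable def compactOps : NonUnitalSubalgebra ℂ (X →L[ℂ] X) :=
  (finiteRankOps A X).topologicalClosure

variable {X}

/-- `S` is an adjoint of `T` for the `A`-valued inner product. -/
def IsAdjointOf (T S : X →L[ℂ] X) : Prop :=
  ∀ x y : X, rinner A (T x) y = rinner A x (S y)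

variable {A}

namespace IsAdjointOf

theorem symm {T S : X →L[ℂ] X} (h : IsAdjointOf A T S) : IsAdjointOf A S T := fun x y => by
  rw [← star_rinner, ← h, star_rinner]

theorem unique {T S S' : X →L[ℂ] X} (h : IsAdjointOf A T S) (h' : IsAdjointOf A T S') :
    S = S' := by
  ext y
  exact ext_rinner (A := A) fun w => by rw [← h, ← h']

theorem norm_le {T S : X →L[ℂ] X} (h : IsAdjointOf A T S) : ‖S‖ ≤ ‖T‖ := by
  refine S.opNorm_le_bound (norm_nonneg _) fun y => ?_
  have h1 : ‖S y‖ ^ 2 ≤ ‖T‖ * ‖y‖ * ‖S y‖ := by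
    rw [norm_sq_eq_rinner (A := A), ← h]
    calc ‖rinner A (T (S y)) y‖ ≤ ‖T (S y)‖ * ‖y‖ := norm_rinner_le _ _
      _ ≤ ‖T‖ * ‖S y‖ * ‖y‖ := by gcongr; exact T.le_opNorm _
      _ = ‖T‖ * ‖y‖ * ‖S y‖ := by ring
  rcases (norm_nonneg (S y)).eq_or_lt with h0 | h0
  · rw [← h0]; positivity
  · rw [pow_two] at h1
    exact le_of_mul_le_mul_right h1 h0

theorem add {T S T' S' : X →L[ℂ] X} (h : IsAdjointOf A T S) (h' : IsAdjointOf A T' S') :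
    IsAdjointOf A (T + T') (S + S') := fun x y => by
  simp only [_root_.add_apply, rinner_add_left, rinner_add_right, h x y, h' x y]

theorem sub {T S T' S' : X →L[ℂ] X} (h : IsAdjointOf A T S) (h' : IsAdjointOf A T' S') :
    IsAdjointOf A (T - T') (S - S') := fun x y => by
  simp only [_root_.sub_apply, rinner_sub_left, rinner_sub_right, h x y, h' x y]

theorem smul (c : ℂ) {T S : X →L[ℂ] X} (h : IsAdjointOf A T S) :
    IsAdjointOf A (c • T) (star c • S) := fun x y => by
  simp only [_root_.smul_apply, rinner_complex_smul_left, rinner_complex_smul_right,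
    h x y]

theorem mul {T S T' S' : X →L[ℂ] X} (h : IsAdjointOf A T S) (h' : IsAdjointOf A T' S') :
    IsAdjointOf A (T * T') (S' * S) := fun x y => by
  simp only [_root_.mul_apply_eq_comp, h _ _, h' _ _]

theorem zero : IsAdjointOf A (0 : X →L[ℂ] X) 0 := fun x y => by
  simp [rinner]

theorem theta (x y : X) : IsAdjointOf A (theta A x y) (theta A y x) := fun u v => by
  rw [theta_apply, theta_apply, rinner_smul_left, rinner_smul_right, star_rinner]

end IsAdjointOf

theorem continuous_rinner_left (y : X) : Continuous fun x : X => rinner A x y :=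
  MulOpposite.continuous_unop.comp
    ((CStarModule.continuous_inner (A := Aᵐᵒᵖ) (E := X)).comp (by fun_prop :
      Continuous fun x : X => (x, y)))

theorem continuous_rinner_right (x : X) : Continuous fun y : X => rinner A x y :=
  MulOpposite.continuous_unop.comp
    ((CStarModule.continuous_inner (A := Aᵐᵒᵖ) (E := X)).comp (by fun_prop :
      Continuous fun y : X => (x, y)))

theorem exists_adjoint_finiteRank {T : X →L[ℂ] X} (hT : T ∈ finiteRankOps A X) :
    ∃ S ∈ finiteRankOps A X, IsAdjointOf A T S := by
  change T ∈ Submodule.span ℂ {T : X →L[ℂ] X | ∃ x y : X, T = HilbertModule.theta A x y} at hT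
  induction hT using Submodule.span_induction with
  | mem T h =>
    obtain ⟨x, y, rfl⟩ := h
    exact ⟨_, Submodule.subset_span ⟨y, x, rfl⟩, IsAdjointOf.theta x y⟩
  | zero => exact ⟨0, zero_mem _, IsAdjointOf.zero⟩
  | add T T' _ _ h h' =>
    obtain ⟨S, hS, hTS⟩ := h
    obtain ⟨S', hS', hTS'⟩ := h'
    exact ⟨S + S', add_mem hS hS', hTS.add hTS'⟩
  | smul c T _ h =>
    obtain ⟨S, hS, hTS⟩ := h
    exact ⟨star c • S, Submodule.smul_mem (finiteRankOps A X).toSubmodule _ hS, hTS.smul c⟩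

theorem exists_adjoint [CompleteSpace X] {T : X →L[ℂ] X} (hT : T ∈ compactOps A X) :
    ∃ S ∈ compactOps A X, IsAdjointOf A T S := by
  obtain ⟨t, ht, htT⟩ := mem_closure_iff_seq_limit.1 hT
  choose s hs hts using fun n => exists_adjoint_finiteRank (ht n)
  have hcau : CauchySeq s := by
    refine Metric.cauchySeq_iff.2 fun ε hε => ?_
    obtain ⟨N, hN⟩ := Metric.cauchySeq_iff.1 htT.cauchySeq ε hε
    refine ⟨N, fun m hm n hn => lt_of_le_of_lt ?_ (hN m hm n hn)⟩
    rw [dist_eq_norm, dist_eq_norm]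
    exact ((hts m).sub (hts n)).norm_le
  obtain ⟨S, hS⟩ := cauchySeq_tendsto_of_complete hcau
  refine ⟨S, mem_closure_iff_seq_limit.2 ⟨s, hs, hS⟩, fun x y => ?_⟩
  have h1 := ((continuous_rinner_left (A := A) y).tendsto (T x)).comp
    (((ContinuousLinearMap.apply ℂ X x).continuous.tendsto T).comp htT)
  have h2 := ((continuous_rinner_right (A := A) x).tendsto (S y)).comp
    (((ContinuousLinearMap.apply ℂ X y).continuous.tendsto S).comp hS)
  refine tendsto_nhds_unique h1 (h2.congr fun n => ?_)
  exact (hts n x y).symm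

variable [CompleteSpace X]

/-- The involution of `K(X)`: `star T` is the adjoint of `T`. -/
noncomputable instance : Star (compactOps A X) where
  star T := ⟨(exists_adjoint T.2).choose, (exists_adjoint T.2).choose_spec.1⟩

theorem isAdjointOf_star (T : compactOps A X) :
    IsAdjointOf A (T : X →L[ℂ] X) (star T : compactOps A X) :=
  (exists_adjoint T.2).choose_spec.2

theorem star_eq_of_isAdjointOf {T S : compactOps A X}
    (h : IsAdjointOf A (T : X →L[ℂ] X) (S : X →L[ℂ] X)) : star T = S :=
  Subtype.ext ((isAdjointOf_star T).unique h)

noncomputable instance : StarRing (compactOps A X) where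
  star_involutive T := star_eq_of_isAdjointOf (isAdjointOf_star T).symm
  star_mul S T := star_eq_of_isAdjointOf ((isAdjointOf_star S).mul (isAdjointOf_star T))
  star_add S T := star_eq_of_isAdjointOf ((isAdjointOf_star S).add (isAdjointOf_star T))

/-- `K(X)` is a C⋆-algebra. -/
noncomputable instance : NonUnitalCStarAlgebra (compactOps A X) where
  toCompleteSpace :=
    (NonUnitalSubalgebra.isClosed_topologicalClosure (finiteRankOps A X)).completeSpace_coe
  norm_smul_le c T := norm_smul_le c (T : X →L[ℂ] X)
  norm_mul_self_le T := by
    have key : ∀ x : X, ‖(T : X →L[ℂ] X) x‖ ^ 2 ≤ ‖star T * T‖ * ‖x‖ ^ 2 := fun x => by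
      rw [norm_sq_eq_rinner (A := A), isAdjointOf_star T x ((T : X →L[ℂ] X) x)]
      refine (norm_rinner_le _ _).trans ?_
      calc ‖x‖ * ‖((star T : compactOps A X) : X →L[ℂ] X) ((T : X →L[ℂ] X) x)‖
          ≤ ‖x‖ * (‖star T * T‖ * ‖x‖) := by
            gcongr
            exact ((star T * T : compactOps A X) : X →L[ℂ] X).le_opNorm x
        _ = ‖star T * T‖ * ‖x‖ ^ 2 := by ring
    have h : ‖(T : X →L[ℂ] X)‖ ≤ √‖star T * T‖ := by
      refine ContinuousLinearMap.opNorm_le_bound _ (Real.sqrt_nonneg _) fun x => ?_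
      refine le_of_sq_le_sq ?_ (by positivity)
      rw [mul_pow, Real.sq_sqrt (norm_nonneg (star T * T))]
      exact key x
    calc ‖T‖ * ‖T‖ ≤ √‖star T * T‖ * √‖star T * T‖ :=
          mul_le_mul h h (norm_nonneg _) (Real.sqrt_nonneg _)
      _ = ‖star T * T‖ := Real.mul_self_sqrt (norm_nonneg _)
  star_smul c T := star_eq_of_isAdjointOf ((isAdjointOf_star T).smul c)

variable (A)

/-- `θ_{x,y}` as an element of `K(X)`. -/
noncomputable def thetaK (x y : X) : compactOps A X :=
  ⟨theta A x y, subset_closure (Submodule.subset_span ⟨x, y, rfl⟩)⟩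

end Compact

end HilbertModule

/-! ### Completely positive maps, `φ`-maps and their dilations -/

namespace TernaryDomain

open HilbertModule ContinuousLinearMap

universe u v w z

section Domains

variable {A : Type u} [NonUnitalCStarAlgebra A] [PartialOrder A] [StarOrderedRing A]
  {X : Type v} [NormedAddCommGroup X] [NormedSpace ℂ X] [SMul Aᵐᵒᵖ X] [CStarModule Aᵐᵒᵖ X]
  {H : Type w} [NormedAddCommGroup H] [InnerProductSpace ℂ H] [CompleteSpace H]
  {K : Type z} [NormedAddCommGroup K] [InnerProductSpace ℂ K] [CompleteSpace K]

/-- `Φ : X → L(H, K)` is a `φ`-map: `Φ(x)* Φ(y) = φ(⟨x, y⟩)`. -/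
def IsPhiMap (φ : A → (H →L[ℂ] H)) (Φ : X → (H →L[ℂ] K)) : Prop :=
  ∀ x y : X, adjoint (Φ x) ∘L Φ y = φ (rinner A x y)

/-- The multiplicative domain `M_φ` of `φ`. -/
def multiplicativeDomain (φ : A → (H →L[ℂ] H)) : Set A :=
  {a | ∀ b : A, φ (a * b) = φ a * φ b ∧ φ (b * a) = φ b * φ a}

/-- The ternary domain `T_φ` of `φ`. -/
def ternaryIdeal (φ : A → (H →L[ℂ] H)) : Set A :=
  {a | a ∈ multiplicativeDomain φ ∧
    ∀ b c : A, φ (b * star a * c) = φ b * star (φ a) * φ c}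

/-- The `φ`-module domain `X_Φ` of a map `Φ : X → L(H, K)`. -/
def moduleDomain (φ : A → (H →L[ℂ] H)) (Φ : X → (H →L[ℂ] K)) : Set X :=
  {x | ∀ b : A, Φ (x <• b) = Φ x ∘L φ b}

end Domains

/-- A minimal Stinespring representation `((Π, π), (W, V), (H', K'))` associated to `(φ, Φ)`. -/
structure MinimalStinespring {A : Type u} [NonUnitalCStarAlgebra A] [PartialOrder A]
    [StarOrderedRing A]
    {X : Type v} [NormedAddCommGroup X] [NormedSpace ℂ X] [SMul Aᵐᵒᵖ X] [CStarModule Aᵐᵒᵖ X]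
    {H : Type w} [NormedAddCommGroup H] [InnerProductSpace ℂ H] [CompleteSpace H]
    {K : Type z} [NormedAddCommGroup K] [InnerProductSpace ℂ K] [CompleteSpace K]
    (φ : A → (H →L[ℂ] H)) (Φ : X → (H →L[ℂ] K))
    (H' : Type*) [NormedAddCommGroup H'] [InnerProductSpace ℂ H'] [CompleteSpace H']
    (K' : Type*) [NormedAddCommGroup K'] [InnerProductSpace ℂ K'] [CompleteSpace K'] where
  /-- the ⋆-representation `π` of `A` on `H'` -/
  repA : A →⋆ₙₐ[ℂ] (H' →L[ℂ] H')
  /-- the `π`-representation `Π` of `X` -/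
  repX : X → (H' →L[ℂ] K')
  /-- the bounded operator `V` -/
  V : H →L[ℂ] H'
  /-- the coisometry `W` -/
  W : K →L[ℂ] K'
  repX_isPhiMap : IsPhiMap repA repX
  coisometry : W ∘L adjoint W = ContinuousLinearMap.id ℂ K'
  dilation_phi : ∀ a : A, φ a = adjoint V ∘L repA a ∘L V
  dilation_Phi : ∀ x : X, Φ x = adjoint W ∘L repX x ∘L V
  minimal_left :
    (Submodule.span ℂ {ξ : H' | ∃ (a : A) (h : H), ξ = repA a (V h)}).topologicalClosure = ⊤
  minimal_right :
    (Submodule.span ℂ {η : K' | ∃ (x : X) (h : H), η = repX x (V h)}).topologicalClosure = ⊤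

/-- `ϕ` is the ⋆-representation `ϕ_{Φ,φ}` of `K(X)` on `K` induced by `(φ, Φ)`, that is
`ϕ(T) = W* Γ(T) W`, where `((Π, π), (W, V), (H', K'))` is a minimal Stinespring representation
associated to `(φ, Φ)` and `Γ` is the ⋆-representation of `K(X)` on `K'` with
`Γ(θ_{x,y}) = Π(x) Π(y)*`. -/
def IsInducedRep {A : Type u} [NonUnitalCStarAlgebra A] [PartialOrder A] [StarOrderedRing A]
    {X : Type v} [NormedAddCommGroup X] [NormedSpace ℂ X] [CompleteSpace X]
    [SMul Aᵐᵒᵖ X] [CStarModule Aᵐᵒᵖ X]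
    {H : Type w} [NormedAddCommGroup H] [InnerProductSpace ℂ H] [CompleteSpace H]
    {K : Type z} [NormedAddCommGroup K] [InnerProductSpace ℂ K] [CompleteSpace K]
    (φ : A → (H →L[ℂ] H)) (Φ : X → (H →L[ℂ] K))
    (ϕ : compactOps A X →⋆ₙₐ[ℂ] (K →L[ℂ] K)) : Prop :=
  ∃ (H' : Type (max u w)) (_ : NormedAddCommGroup H') (_ : InnerProductSpace ℂ H')
    (_ : CompleteSpace H')
    (K' : Type z) (_ : NormedAddCommGroup K') (_ : InnerProductSpace ℂ K') (_ : CompleteSpace K')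
    (R : MinimalStinespring φ Φ H' K') (Γ : compactOps A X →⋆ₙₐ[ℂ] (K' →L[ℂ] K')),
    (∀ x y : X, Γ (thetaK A x y) = R.repX x ∘L adjoint (R.repX y)) ∧
    ∀ T : compactOps A X, ϕ T = adjoint R.W ∘L Γ T ∘L R.W

end TernaryDomain

/-! The dilation turns every claim into operator algebra. Since Φ(x) = W*Π(x)V and φ(b) = V*π(b)V,
the identity Φ(xb) = Φ(x)φ(b) reads W*Π(x)π(b)V = W*Π(x)VV*π(b)V. Cancelling the isometry W* and the
total family π(b)V shows that x ∈ X_φ exactly when Π(x) = Π(x)VV*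
(`MinimalStinespring.mem_moduleDomain_iff`). Claims 3 to 5 follow by comparing W*Π(x)Π(y)*W with
W*Π(x)VV*Π(y)*W; for the converses with φ contractive, V is a contraction and Π(x)Π(x)* =
Π(x)VV*Π(x)* already forces Π(x) = Π(x)VV* (`comp_contraction_eq`).

Claim 1 is Γ(T)Π(z) = Π(Tz), checked on the θ_{x,y} and extended by continuity. It fixes ϕ on the
closed span of the ranges of Φ, and ϕ vanishes on the orthogonal complement, so ϕ is unique. X_φ
does not depend on Φ because D*D, for the defect D = Φ(xb) - Φ(x)φ(b), is an expression in φ alone.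

Existence comes from a Kolmogorov decomposition of φ(a*b), with `exists_rep_of_action` supplying
both π and Γ. As A need not have a unit, V and the bounds on it are obtained through an approximate
unit. -/

namespace TernaryDomain

open HilbertModule ContinuousLinearMap Filter
open scoped InnerProductSpace Topology

universe u v w z

/-! ### Total families of operators -/

section Total

variable {S : Type*}
  {H : Type*} [NormedAddCommGroup H] [InnerProductSpace ℂ H]
  {E : Type*} [NormedAddCommGroup E] [InnerProductSpace ℂ E]
  {F : Type*} [NormedAddCommGroup F] [InnerProductSpace ℂ F]

/-- A family of operators `v s : H → E` is total if the ranges span a dense subspace of `E`. -/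
def IsTotal (v : S → (H →L[ℂ] E)) : Prop :=
  (Submodule.span ℂ {ξ : E | ∃ (s : S) (h : H), ξ = v s h}).topologicalClosure = ⊤

/-- The map `f ↦ ∑ v s (f s)`. -/
noncomputable def synthesis (v : S → (H →L[ℂ] E)) : (S →₀ H) →ₗ[ℂ] E :=
  Finsupp.lsum ℂ fun s => (v s : H →ₗ[ℂ] E)

theorem synthesis_apply (v : S → (H →L[ℂ] E)) (f : S →₀ H) :
    synthesis v f = f.sum fun s h => v s h := rfl

@[simp]
theorem synthesis_single (v : S → (H →L[ℂ] E)) (s : S) (h : H) :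
    synthesis v (Finsupp.single s h) = v s h := by
  simp [synthesis]

theorem range_synthesis (v : S → (H →L[ℂ] E)) :
    LinearMap.range (synthesis v) = Submodule.span ℂ {ξ : E | ∃ (s : S) (h : H), ξ = v s h} := by
  apply le_antisymm
  · rintro _ ⟨f, rfl⟩
    exact Submodule.sum_mem _ fun s _ => Submodule.subset_span ⟨s, f s, rfl⟩
  · refine Submodule.span_le.2 ?_
    rintro _ ⟨s, h, rfl⟩
    exact ⟨Finsupp.single s h, synthesis_single v s h⟩

theorem IsTotal.denseRange {v : S → (H →L[ℂ] E)} (hv : IsTotal v) : DenseRange (synthesis v) := by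
  have h := Submodule.dense_iff_topologicalClosure_eq_top.2 hv
  rwa [← range_synthesis, LinearMap.coe_range] at h

theorem IsTotal.ext {v : S → (H →L[ℂ] E)} (hv : IsTotal v) {T T' : E →L[ℂ] F}
    (h : ∀ s, T ∘L v s = T' ∘L v s) : T = T' := by
  refine ContinuousLinearMap.ext_on (Submodule.dense_iff_topologicalClosure_eq_top.2 hv) ?_
  rintro _ ⟨s, x, rfl⟩
  exact DFunLike.congr_fun (h s) x

/-- The norm bound gives both well-definedness of v s h ↦ w s h on the span and its continuous
extension to E. -/
theorem IsTotal.exists_extension [CompleteSpace F] {v : S → (H →L[ℂ] E)} (hv : IsTotal v)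
    (w : S → (H →L[ℂ] F)) (C : ℝ) (hC : ∀ f, ‖synthesis w f‖ ≤ C * ‖synthesis v f‖) :
    ∃ T : E →L[ℂ] F, ∀ s, T ∘L v s = w s := by
  refine ⟨(synthesis w).extendOfNorm (synthesis v), fun s => ?_⟩
  ext h
  have := LinearMap.extendOfNorm_eq (f := synthesis w) (e := synthesis v) hv.denseRange ⟨C, hC⟩
    (Finsupp.single s h)
  simpa using this

variable [CompleteSpace H] [CompleteSpace E] [CompleteSpace F]

theorem IsTotal.ext_adjoint {v : S → (H →L[ℂ] E)} (hv : IsTotal v) {T T' : F →L[ℂ] E}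
    (h : ∀ s, adjoint (v s) ∘L T = adjoint (v s) ∘L T') : T = T' := by
  refine adjoint.injective (hv.ext fun s => ?_)
  have := congrArg adjoint (h s)
  simpa only [adjoint_comp, adjoint_adjoint] using this

end Total

/-- An operator `D` with `D* D = 0` vanishes. -/
theorem eq_zero_of_adjoint_comp_self {H K : Type*} [NormedAddCommGroup H] [InnerProductSpace ℂ H]
    [CompleteSpace H] [NormedAddCommGroup K] [InnerProductSpace ℂ K] [CompleteSpace K]
    {D : H →L[ℂ] K} (h : adjoint D ∘L D = 0) : D = 0 := by
  have h1 := norm_adjoint_comp_self D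
  rw [h, norm_zero] at h1
  exact norm_eq_zero.1 (mul_self_eq_zero.1 h1.symm)

/-! ### Representations obtained from algebraic actions -/

section Action

variable {B : Type*} [NonUnitalCStarAlgebra B]
  {S : Type*} [AddCommGroup S] [Module ℂ S]
  {H : Type*} [NormedAddCommGroup H] [InnerProductSpace ℂ H] [CompleteSpace H]
  {E : Type*} [NormedAddCommGroup E] [InnerProductSpace ℂ E] [CompleteSpace E]

theorem synthesis_add (v w : S → (H →L[ℂ] E)) (f : S →₀ H) :
    synthesis (fun s => v s + w s) f = synthesis v f + synthesis w f := by
  simp [synthesis_apply, Finsupp.sum_add]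

theorem synthesis_smul (c : ℂ) (v : S → (H →L[ℂ] E)) (f : S →₀ H) :
    synthesis (fun s => c • v s) f = c • synthesis v f := by
  simp [synthesis_apply, Finsupp.smul_sum]

theorem inner_synthesis (v w : S → (H →L[ℂ] E)) (f g : S →₀ H) :
    ⟪synthesis v f, synthesis w g⟫_ℂ =
      f.sum fun s h => g.sum fun t k => ⟪h, (adjoint (v s) ∘L w t) k⟫_ℂ := by
  simp only [synthesis_apply, Finsupp.sum_inner, Finsupp.inner_sum, adjoint_inner_right,
    ContinuousLinearMap.comp_apply]
  exact Finsupp.sum_comm _ _ _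

/-- Writing ‖T‖² - T*T = c*c gives ‖T‖²‖ξ‖² - ‖Tξ‖² = ‖cξ‖² ≥ 0. The computation stays with formal
sums f, because the action on vectors of E is not yet known to be well defined. -/
theorem norm_synthesis_action_le (v : S →ₗ[ℂ] (H →L[ℂ] E)) (ρ : B →ₗ[ℂ] S →ₗ[ℂ] S)
    (hmul : ∀ T T' s, ρ (T * T') s = ρ T (ρ T' s))
    (hadj : ∀ T s t, adjoint (v (ρ T s)) ∘L v t = adjoint (v s) ∘L v (ρ (star T) t))
    (T : B) (f : S →₀ H) :
    ‖synthesis (fun s => v (ρ T s)) f‖ ≤ ‖T‖ * ‖synthesis v f‖ := by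
  -- The element c lives in the unitization, so the action is extended there; `L z` plays the role
  -- of zξ.
  let ρ' : Unitization ℂ B → S → S := fun z s => z.fst • s + ρ z.snd s
  let L : Unitization ℂ B → E := fun z => synthesis (fun s => v (ρ' z s)) f
  have hmul' : ∀ z z' s, ρ' (z * z') s = ρ' z (ρ' z' s) := fun z z' s => by
    simp [ρ', hmul, smul_smul, add_assoc]
  have hadj' : ∀ z s t, adjoint (v (ρ' z s)) ∘L v t = adjoint (v s) ∘L v (ρ' (star z) t) :=
    fun z s t => by
      simp only [ρ', map_add, map_smul, map_smulₛₗ, ContinuousLinearMap.add_comp,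
        ContinuousLinearMap.comp_add, ContinuousLinearMap.smul_comp, ContinuousLinearMap.comp_smul,
        hadj, Unitization.fst_star, Unitization.snd_star]
      rfl
  have hL : ∀ z z', ⟪L z, L z'⟫_ℂ = ⟪synthesis v f, L (star z * z')⟫_ℂ := fun z z' => by
    simp only [L, inner_synthesis, hmul', hadj']
  have hLadd : ∀ z z', L (z + z') = L z + L z' := fun z z' => by
    simp only [L, ← synthesis_add]
    congr 2
    ext s : 1
    simp only [ρ', Unitization.fst_add, Unitization.snd_add, add_smul, map_add,
      LinearMap.add_apply]
    abel
  have hLinr : ∀ b : B, L (b : Unitization ℂ B) = synthesis (fun s => v (ρ b s)) f := fun b => by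
    simp [L, ρ']
  have hLone : ∀ c : ℂ, L (algebraMap ℂ _ c) = c • synthesis v f := fun c => by
    simp [L, ρ', Unitization.algebraMap_eq_inl, ← synthesis_smul]
  let _ := CStarAlgebra.spectralOrder (Unitization ℂ B)
  have _ := CStarAlgebra.spectralOrderedRing (Unitization ℂ B)
  have hle : star (T : Unitization ℂ B) * T ≤ algebraMap ℝ _ (‖T‖ ^ 2) := by
    have := CStarAlgebra.star_mul_le_algebraMap_norm_sq (a := (T : Unitization ℂ B))
    rwa [Unitization.norm_inr] at this
  obtain ⟨c, hc⟩ := CStarAlgebra.nonneg_iff_eq_star_mul_self.1 (sub_nonneg.2 hle)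
  have e1 : L (algebraMap ℂ _ ((‖T‖ ^ 2 : ℝ) : ℂ)) =
      L (star c * c) + L (star (T : Unitization ℂ B) * T) := by
    rw [← hLadd, ← hc, sub_add_cancel]
    rfl
  have e2 := congrArg (fun ξ => (⟪synthesis v f, ξ⟫_ℂ).re) e1
  simp only [inner_add_right, ← hL, hLone, inner_smul_right, Complex.add_re,
    inner_self_eq_norm_sq_to_K, Complex.coe_algebraMap, ← Complex.ofReal_pow,
    ← Complex.ofReal_mul, Complex.ofReal_re] at e2
  have e3 : ‖T‖ ^ 2 * ‖synthesis v f‖ ^ 2 = ‖L c‖ ^ 2 + ‖L T‖ ^ 2 := by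
    exact e2
  rw [← hLinr]
  refine le_of_sq_le_sq ?_ (by positivity)
  rw [mul_pow, e3]
  nlinarith [sq_nonneg ‖L c‖]

/-- A C⋆-algebra acting on a total family, compatibly with the involution, is represented
by bounded operators. -/
theorem exists_rep_of_action (v : S →ₗ[ℂ] (H →L[ℂ] E)) (hv : IsTotal v)
    (ρ : B →ₗ[ℂ] S →ₗ[ℂ] S)
    (hmul : ∀ T T' s, ρ (T * T') s = ρ T (ρ T' s))
    (hadj : ∀ T s t, adjoint (v (ρ T s)) ∘L v t = adjoint (v s) ∘L v (ρ (star T) t)) :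
    ∃ Γ : B →⋆ₙₐ[ℂ] (E →L[ℂ] E), ∀ T s, Γ T ∘L v s = v (ρ T s) := by
  choose Γ hΓ using fun T => hv.exists_extension (fun s => v (ρ T s)) ‖T‖
    (norm_synthesis_action_le v ρ hmul hadj T)
  refine ⟨
    { toFun := Γ
      map_smul' := fun c T => hv.ext fun s => ?_
      map_zero' := hv.ext fun s => ?_
      map_add' := fun T T' => hv.ext fun s => ?_
      map_mul' := fun T T' => hv.ext fun s => ?_
      map_star' := fun T => hv.ext fun s => hv.ext_adjoint fun t => ?_ }, hΓ⟩
  · simp [ContinuousLinearMap.smul_comp, hΓ]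
  · simp [hΓ]
  · simp [ContinuousLinearMap.add_comp, hΓ]
  · rw [ContinuousLinearMap.mul_def, ContinuousLinearMap.comp_assoc, hΓ, hΓ, hΓ, hmul]
  · rw [hΓ, ← hadj, ContinuousLinearMap.star_eq_adjoint, ← ContinuousLinearMap.comp_assoc,
      ← adjoint_comp, hΓ]

end Action

/-! ### Complete positivity and the Kolmogorov decomposition -/

section CompletelyPositive

variable {A : Type u} [NonUnitalCStarAlgebra A] [PartialOrder A] [StarOrderedRing A]
  {H : Type w} [NormedAddCommGroup H] [InnerProductSpace ℂ H] [CompleteSpace H]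

/-- Positive elements lie in the additive monoid generated by the M*M, and for M*M the form is a sum
of squared norms. -/
theorem re_sum_inner_nonneg_of_cstarMatrix_nonneg {ι : Type*} [Fintype ι] [DecidableEq ι]
    {N : CStarMatrix ι ι (H →L[ℂ] H)} (hN : 0 ≤ N) (h : ι → H) :
    0 ≤ (∑ i, ∑ j, ⟪h i, N i j (h j)⟫_ℂ).re := by
  rw [StarOrderedRing.nonneg_iff] at hN
  induction hN using AddSubmonoid.closure_induction with
  | zero => simp
  | add N N' _ _ hN hN' =>
    simpa [inner_add_right, Finset.sum_add_distrib] using add_nonneg hN hN'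
  | mem N hN =>
  obtain ⟨M, rfl⟩ := hN
  have : ∑ i, ∑ j, ⟪h i, (star M * M) i j (h j)⟫_ℂ =
      ∑ k, ⟪∑ i, M k i (h i), ∑ j, M k j (h j)⟫_ℂ := by
    simp only [sum_inner, inner_sum, CStarMatrix.mul_apply, CStarMatrix.star_apply,
      _root_.sum_apply, ContinuousLinearMap.star_eq_adjoint,
      ContinuousLinearMap.mul_def, ContinuousLinearMap.comp_apply, adjoint_inner_right]
    rw [Finset.sum_comm_cycle]
    refine Finset.sum_congr rfl fun _ _ => Finset.sum_comm
  rw [this, Complex.re_sum]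
  exact Finset.sum_nonneg fun k _ => inner_self_nonneg (𝕜 := ℂ)

theorem _root_.CompletelyPositiveMap.re_sum_inner_nonneg
    (φ : CompletelyPositiveMap A (H →L[ℂ] H)) {ι : Type*} [Fintype ι] [DecidableEq ι]
    (b : ι → A) (h : ι → H) :
    0 ≤ (∑ i, ∑ j, ⟪h i, φ (star (b i) * b j) (h j)⟫_ℂ).re := by
  rcases isEmpty_or_nonempty ι with hι | ⟨⟨k⟩⟩
  · simp
  -- A square matrix whose only nonzero row is b, so that B*B has entries b_i* b_j.
  let B : CStarMatrix ι ι A := CStarMatrix.ofMatrix (Matrix.of fun i j => if i = k then b j else 0)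
  have hB' : ∀ i j, B i j = if i = k then b j else 0 := fun _ _ => rfl
  have hB : ∀ i j, (star B * B) i j = star (b i) * b j := fun i j => by
    simp only [CStarMatrix.mul_apply, CStarMatrix.star_apply, hB']
    simp
  have := re_sum_inner_nonneg_of_cstarMatrix_nonneg
    (φ.map_cstarMatrix_nonneg (star B * B) (star_mul_self_nonneg B)) h
  simpa only [CStarMatrix.map_apply, hB] using this

theorem _root_.CompletelyPositiveMap.adjoint_apply
    (φ : CompletelyPositiveMap A (H →L[ℂ] H)) (a : A) : adjoint (φ a) = φ (star a) := by
  rw [← ContinuousLinearMap.star_eq_adjoint, map_star]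

theorem _root_.CompletelyPositiveMap.exists_norm_apply_le
    (φ : CompletelyPositiveMap A (H →L[ℂ] H)) : ∃ C : ℝ, 0 ≤ C ∧ ∀ a, ‖φ a‖ ≤ C * ‖a‖ := by
  obtain ⟨C, hC⟩ := PositiveLinearMap.exists_norm_apply_le
    (PositiveLinearMap.mk₀ (φ : A →ₗ[ℂ] (H →L[ℂ] H)) fun a ha => map_nonneg φ ha)
  exact ⟨C, C.2, hC⟩

theorem _root_.CompletelyPositiveMap.continuous
    (φ : CompletelyPositiveMap A (H →L[ℂ] H)) : Continuous φ := by
  obtain ⟨C, -, hC⟩ := φ.exists_norm_apply_le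
  exact AddMonoidHomClass.continuous_of_bound φ C hC

theorem _root_.CompletelyPositiveMap.posSemidef_kernel
    (φ : CompletelyPositiveMap A (H →L[ℂ] H)) :
    Matrix.PosSemidef (Matrix.of fun a b : A => φ (star a * b)) := by
  have tfae := RKHS.posSemidef_tfae (𝕜 := ℂ) (K := Matrix.of fun a b : A => φ (star a * b))
  have iff := tfae.out 0 2
  refine iff.2 ⟨?_, fun f => ?_⟩
  · ext1 a b
    simp [Matrix.conjTranspose_apply, ContinuousLinearMap.star_eq_adjoint, φ.adjoint_apply]
  · classical
    have hpos := φ.re_sum_inner_nonneg (fun a : f.support => (a : A)) (fun a => f a)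
    have hsum : ∑ a : f.support, ∑ b : f.support, ⟪f a, φ (star (a : A) * b) (f b)⟫_ℂ =
        f.sum fun a h => f.sum fun b k => ⟪h, φ (star a * b) k⟫_ℂ := by
      rw [Finset.sum_coe_sort f.support
        fun a => ∑ b : f.support, ⟪f a, φ (star a * b) (f b)⟫_ℂ]
      exact Finset.sum_congr rfl fun a _ =>
        Finset.sum_coe_sort f.support fun b => ⟪f a, φ (star a * b) (f b)⟫_ℂ
    rw [hsum] at hpos
    refine hpos.trans_eq (congrArg Complex.re ?_)
    refine Finsupp.sum_congr fun a _ => Finsupp.sum_congr fun b _ => ?_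
    rw [Matrix.of_apply, ← adjoint_inner_right, φ.adjoint_apply, star_mul, star_star]

/-- The Kolmogorov decomposition of the kernel `(a, b) ↦ φ(a* b)`. -/
theorem _root_.CompletelyPositiveMap.exists_kolmogorov
    (φ : CompletelyPositiveMap A (H →L[ℂ] H)) :
    ∃ (E : Type (max u w)) (_ : NormedAddCommGroup E) (_ : InnerProductSpace ℂ E)
      (_ : CompleteSpace E) (v : A →ₗ[ℂ] (H →L[ℂ] E)), IsTotal v ∧
      ∀ a b, adjoint (v a) ∘L v b = φ (star a * b) := by
  have := Fact.mk φ.posSemidef_kernel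
  let E := RKHS.OfKernel (Matrix.of fun a b : A => φ (star a * b))
  let v : A → (H →L[ℂ] E) := RKHS.kerFun E
  have hv : IsTotal v := by
    have := RKHS.kerFun_dense (𝕜 := ℂ) (X := A) (V := H) E
    simpa only [IsTotal, eq_comm] using this
  have hφ : ∀ a b, adjoint (v a) ∘L v b = φ (star a * b) := fun a b => by
    rw [← RKHS.kernel_apply, RKHS.OfKernel.kernel_ofKernel, Matrix.of_apply]
  refine ⟨E, inferInstance, inferInstance, inferInstance,
    { toFun := v
      map_add' := fun a b => hv.ext_adjoint fun c => ?_
      map_smul' := fun c a => hv.ext_adjoint fun b => ?_ }, hv, hφ⟩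
  · simp only [ContinuousLinearMap.comp_add, hφ, mul_add, map_add]
  · simp only [RingHom.id_apply, ContinuousLinearMap.comp_smul, hφ, mul_smul_comm, map_smul]

end CompletelyPositive

/-! ### Stinespring dilation without a unit -/

section Stinespring

variable {A : Type u} [NonUnitalCStarAlgebra A] [PartialOrder A] [StarOrderedRing A]
  {H : Type w} [NormedAddCommGroup H] [InnerProductSpace ℂ H] [CompleteSpace H]
  {E : Type*} [NormedAddCommGroup E] [InnerProductSpace ℂ E] [CompleteSpace E]
  (φ : CompletelyPositiveMap A (H →L[ℂ] H))

theorem exists_rep_of_kolmogorov {v : A →ₗ[ℂ] (H →L[ℂ] E)} (hv : IsTotal v)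
    (hφ : ∀ a b, adjoint (v a) ∘L v b = φ (star a * b)) :
    ∃ π : A →⋆ₙₐ[ℂ] (E →L[ℂ] E), ∀ a b, π a ∘L v b = v (a * b) :=
  exists_rep_of_action v hv (LinearMap.mul ℂ A) (fun a b c => by simp [mul_assoc])
    fun a b c => by simp [hφ, mul_assoc]

/-- This makes v(a) ↦ φ(a), the future V*, bounded. With a unit it would be v(1)*; here φ(ea) =
v(e*)*v(a) with ‖v(e*)‖ ≤ √C, and e runs through an approximate unit. -/
theorem norm_synthesis_le_of_kolmogorov {v : A →ₗ[ℂ] (H →L[ℂ] E)}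
    (hφ : ∀ a b, adjoint (v a) ∘L v b = φ (star a * b)) {C : ℝ} (hC0 : 0 ≤ C)
    (hC : ∀ a, ‖φ a‖ ≤ C * ‖a‖) (f : A →₀ H) :
    ‖synthesis φ f‖ ≤ √C * ‖synthesis v f‖ := by
  have hl := CStarAlgebra.increasingApproximateUnit A
  have hlim : Tendsto (fun e => synthesis (fun a => φ (e * a)) f) (CStarAlgebra.approximateUnit A)
      (𝓝 (synthesis φ f)) := by
    refine tendsto_finsetSum _ fun a _ => ?_
    exact ((ContinuousLinearMap.apply ℂ H (f a)).continuous.tendsto _).comp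
      ((φ.continuous.tendsto a).comp (hl.tendsto_mul_right a))
  refine le_of_tendsto hlim.norm ?_
  filter_upwards [hl.eventually_norm] with e he
  have h1 : synthesis (fun a => φ (e * a)) f = adjoint (v (star e)) (synthesis v f) := by
    rw [synthesis_apply, synthesis_apply, map_finsuppSum]
    refine Finsupp.sum_congr fun a _ => ?_
    rw [← ContinuousLinearMap.comp_apply, hφ, star_star]
  have h2 : ‖v (star e)‖ ≤ √C := by
    refine Real.le_sqrt_of_sq_le ?_
    rw [sq, ← norm_adjoint_comp_self, hφ, star_star]
    calc ‖φ (e * star e)‖ ≤ C * (‖e‖ * ‖star e‖) := (hC _).trans (by gcongr; exact norm_mul_le _ _)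
      _ ≤ C * (1 * 1) := by rw [norm_star]; gcongr
      _ = C := by ring
  rw [h1]
  refine (ContinuousLinearMap.le_opNorm _ _).trans ?_
  rw [LinearIsometryEquiv.norm_map]
  gcongr

/-- The Stinespring dilation of a completely positive map. -/
theorem _root_.CompletelyPositiveMap.exists_stinespring :
    ∃ (E : Type (max u w)) (_ : NormedAddCommGroup E) (_ : InnerProductSpace ℂ E)
      (_ : CompleteSpace E) (π : A →⋆ₙₐ[ℂ] (E →L[ℂ] E)) (V : H →L[ℂ] E),
      (∀ a, φ a = adjoint V ∘L π a ∘L V) ∧ IsTotal fun a => π a ∘L V := by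
  obtain ⟨E, _, _, _, v, hv, hφ⟩ := φ.exists_kolmogorov
  obtain ⟨π, hπ⟩ := exists_rep_of_kolmogorov φ hv hφ
  obtain ⟨C, hC0, hC⟩ := φ.exists_norm_apply_le
  obtain ⟨T, hT⟩ := hv.exists_extension φ _ (norm_synthesis_le_of_kolmogorov φ hφ hC0 hC)
  have hV : ∀ a, π a ∘L adjoint T = v a := fun a => hv.ext_adjoint fun b => by
    have h1 : adjoint (v b) ∘L π a = adjoint (v (star a * b)) := by
      rw [← hπ, adjoint_comp, map_star, ContinuousLinearMap.star_eq_adjoint, adjoint_adjoint]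
    rw [← ContinuousLinearMap.comp_assoc, h1, ← adjoint_comp, hT, hφ, φ.adjoint_apply, star_mul,
      star_star]
  refine ⟨E, inferInstance, inferInstance, inferInstance, π, adjoint T, fun a => ?_, ?_⟩
  · rw [hV, adjoint_adjoint, hT]
  · simpa only [hV] using hv

end Stinespring

/-! ### Approximate units acting on a Hilbert module -/

section ApproximateUnit

variable {A : Type*} [NonUnitalCStarAlgebra A] [PartialOrder A] [StarOrderedRing A]
  {X : Type*} [NormedAddCommGroup X] [NormedSpace ℂ X] [SMul Aᵐᵒᵖ X] [CStarModule Aᵐᵒᵖ X]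

theorem tendsto_smul_approximateUnit (x : X) :
    Tendsto (fun e : A => x <• e) (CStarAlgebra.approximateUnit A) (𝓝 x) := by
  have hl := CStarAlgebra.increasingApproximateUnit A
  have key : ∀ e : A, ‖e‖ ≤ 1 →
      ‖x <• e - x‖ ^ 2 ≤ 2 * ‖rinner A x x * e - rinner A x x‖ := fun e he => by
    have h : rinner A (x <• e - x) (x <• e - x) =
        star e * (rinner A x x * e - rinner A x x) - (rinner A x x * e - rinner A x x) := by
      simp only [rinner_sub_left, rinner_sub_right, rinner_smul_left, rinner_smul_right, mul_sub,
        sub_mul, mul_assoc]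
      abel
    rw [norm_sq_eq_rinner (A := A), h]
    calc _ ≤ ‖star e‖ * ‖rinner A x x * e - rinner A x x‖ +
            ‖rinner A x x * e - rinner A x x‖ :=
          (norm_sub_le _ _).trans (by gcongr; exact norm_mul_le _ _)
      _ ≤ 1 * ‖rinner A x x * e - rinner A x x‖ + ‖rinner A x x * e - rinner A x x‖ := by
          rw [norm_star]; gcongr
      _ = _ := by ring
  have h0 : Tendsto (fun e : A => 2 * ‖rinner A x x * e - rinner A x x‖)
      (CStarAlgebra.approximateUnit A) (𝓝 0) := by
    simpa using (tendsto_iff_norm_sub_tendsto_zero.1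
      (hl.tendsto_mul_left (rinner A x x))).const_mul 2
  have h1 : Tendsto (fun e : A => ‖x <• e - x‖ ^ 2) (CStarAlgebra.approximateUnit A) (𝓝 0) := by
    refine squeeze_zero' (.of_forall fun _ => by positivity) ?_ h0
    filter_upwards [hl.eventually_norm] with e he using key e he
  rw [tendsto_iff_norm_sub_tendsto_zero]
  simpa using h1.sqrt

end ApproximateUnit

/-! ### Linearity, continuity and module domain of φ-maps -/

section PhiMap

variable {A : Type*} [NonUnitalCStarAlgebra A] [PartialOrder A] [StarOrderedRing A]
  {X : Type*} [NormedAddCommGroup X] [NormedSpace ℂ X] [SMul Aᵐᵒᵖ X] [CStarModule Aᵐᵒᵖ X]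
  {H : Type*} [NormedAddCommGroup H] [InnerProductSpace ℂ H] [CompleteSpace H]
  {K : Type*} [NormedAddCommGroup K] [InnerProductSpace ℂ K] [CompleteSpace K]

namespace IsPhiMap

variable {F : Type*} [FunLike F A (H →L[ℂ] H)] [LinearMapClass F ℂ A (H →L[ℂ] H)] {φ : F}
  {Φ : X → (H →L[ℂ] K)}

/-- Linearity is automatic: for the defect D, expanding D*D leaves only values of the linear map φ,
and they cancel. -/
theorem map_add (hΦ : IsPhiMap φ Φ) (x y : X) : Φ (x + y) = Φ x + Φ y := by
  refine sub_eq_zero.1 (eq_zero_of_adjoint_comp_self ?_)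
  simp only [_root_.map_add, map_sub, ContinuousLinearMap.comp_add, ContinuousLinearMap.comp_sub,
    ContinuousLinearMap.add_comp, ContinuousLinearMap.sub_comp, hΦ _ _, rinner_add_left,
    rinner_add_right]
  abel

theorem map_smul (hΦ : IsPhiMap φ Φ) (c : ℂ) (x : X) : Φ (c • x) = c • Φ x := by
  refine sub_eq_zero.1 (eq_zero_of_adjoint_comp_self ?_)
  have e1 : ∀ y, adjoint (Φ y) ∘L (Φ (c • x) - c • Φ x) = 0 := fun y => by
    rw [ContinuousLinearMap.comp_sub, ContinuousLinearMap.comp_smul, hΦ, hΦ,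
      rinner_complex_smul_right, _root_.map_smul, sub_self]
  rw [map_sub, map_smulₛₗ, ContinuousLinearMap.sub_comp, ContinuousLinearMap.smul_comp, e1, e1,
    smul_zero, sub_zero]

/-- A `φ`-map as a linear map. -/
def toLinearMap (hΦ : IsPhiMap φ Φ) : X →ₗ[ℂ] (H →L[ℂ] K) where
  toFun := Φ
  map_add' := hΦ.map_add
  map_smul' := hΦ.map_smul

theorem continuous (hΦ : IsPhiMap φ Φ) {C : ℝ} (hC0 : 0 ≤ C) (hC : ∀ a, ‖φ a‖ ≤ C * ‖a‖) :
    Continuous Φ := by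
  refine AddMonoidHomClass.continuous_of_bound hΦ.toLinearMap (√C) fun x => ?_
  refine le_of_sq_le_sq ?_ (by positivity)
  rw [mul_pow, Real.sq_sqrt hC0, norm_sq_eq_rinner (A := A) x, sq, ← norm_adjoint_comp_self]
  exact (congrArg norm (hΦ x x)).trans_le (hC _)

/-- The `φ`-module domain is determined by `φ`. -/
theorem mem_moduleDomain_iff {φ : CompletelyPositiveMap A (H →L[ℂ] H)} (hΦ : IsPhiMap φ Φ)
    (x : X) : x ∈ moduleDomain φ Φ ↔ ∀ b : A,
      φ (star b * rinner A x x * b) - φ (star b * rinner A x x) ∘L φ b -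
        (φ (star b) ∘L φ (rinner A x x * b) - φ (star b) ∘L φ (rinner A x x) ∘L φ b) = 0 := by
  refine forall_congr' fun b => ?_
  -- D*D for the defect D involves Φ only through products Φ(u)*Φ(v), hence only φ.
  have h : adjoint (Φ (x <• b) - Φ x ∘L φ b) ∘L (Φ (x <• b) - Φ x ∘L φ b) =
      φ (star b * rinner A x x * b) - φ (star b * rinner A x x) ∘L φ b -
        (φ (star b) ∘L φ (rinner A x x * b) - φ (star b) ∘L φ (rinner A x x) ∘L φ b) := by
    simp only [map_sub, adjoint_comp, ContinuousLinearMap.comp_sub, ContinuousLinearMap.sub_comp,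
      hΦ _ _, ContinuousLinearMap.comp_assoc, φ.adjoint_apply]
    simp only [← ContinuousLinearMap.comp_assoc _ _ (φ b), hΦ _ _, rinner_smul_left, rinner_smul_right, mul_assoc]
    abel
  rw [← h]
  refine ⟨fun e => ?_, fun e => sub_eq_zero.1 (eq_zero_of_adjoint_comp_self e)⟩
  rw [e, sub_self, ContinuousLinearMap.comp_zero]

/-- A `π`-map for a representation `π` is a module map. -/
theorem map_smul_right {π : A →⋆ₙₐ[ℂ] (H →L[ℂ] H)} (hΦ : IsPhiMap π Φ) (x : X) (a : A) :
    Φ (x <• a) = Φ x ∘L π a := by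
  refine sub_eq_zero.1 (eq_zero_of_adjoint_comp_self ?_)
  have e1 : ∀ y, adjoint (Φ y) ∘L (Φ (x <• a) - Φ x ∘L π a) = 0 := fun y => by
    rw [ContinuousLinearMap.comp_sub, ← ContinuousLinearMap.comp_assoc, hΦ, hΦ, rinner_smul_right,
      map_mul, ContinuousLinearMap.mul_def, sub_self]
  rw [map_sub, adjoint_comp, ContinuousLinearMap.sub_comp, ContinuousLinearMap.comp_assoc, e1, e1,
    ContinuousLinearMap.comp_zero, sub_zero]

theorem continuous_of_rep {π : A →⋆ₙₐ[ℂ] (H →L[ℂ] H)} (hΦ : IsPhiMap π Φ) : Continuous Φ :=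
  hΦ.continuous zero_le_one fun a => by
    rw [one_mul]; exact NonUnitalStarAlgHom.norm_apply_le π a

end IsPhiMap

end PhiMap

/-! ### Compact operators -/

section Compact

variable {A : Type*} [NonUnitalCStarAlgebra A] [PartialOrder A] [StarOrderedRing A]
  {X : Type*} [NormedAddCommGroup X] [NormedSpace ℂ X] [CompleteSpace X]
  [SMul Aᵐᵒᵖ X] [CStarModule Aᵐᵒᵖ X]

theorem compactOps_smul_right (T : compactOps A X) (z : X) (b : A) :
    (T : X →L[ℂ] X) (z <• b) = (T : X →L[ℂ] X) z <• b :=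
  ext_rinner (A := A) fun w => by
    rw [rinner_smul_right, ← (isAdjointOf_star T).symm w, rinner_smul_right,
      (isAdjointOf_star T).symm w]

/-- Continuous linear maps on `K(X)` that agree at all `θ_{x,y}` are equal. -/
theorem compactOps_linearMap_ext {G : Type*} [NormedAddCommGroup G] [NormedSpace ℂ G]
    {f g : compactOps A X →ₗ[ℂ] G} (hf : Continuous f) (hg : Continuous g)
    (h : ∀ x y : X, f (thetaK A x y) = g (thetaK A x y)) : f = g := by
  have hfin : ∀ T ∈ finiteRankOps A X, ∀ hT : T ∈ compactOps A X, f ⟨T, hT⟩ = g ⟨T, hT⟩ := by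
    intro T hT
    change T ∈ Submodule.span ℂ {T : X →L[ℂ] X | ∃ x y : X, T = theta A x y} at hT
    induction hT using Submodule.span_induction with
    | mem T h' =>
      obtain ⟨x, y, rfl⟩ := h'
      exact fun _ => h x y
    | zero =>
      intro h0
      exact (map_zero f).trans (map_zero g).symm
    | add T T' hT hT' ih ih' =>
      intro _
      have e := ih (subset_closure hT)
      have e' := ih' (subset_closure hT')
      have := congrArg₂ (· + ·) e e'
      simp only [← map_add] at this
      exact this
    | smul c T hT ih =>
      intro _
      have := congrArg (c • ·) (ih (subset_closure hT))
      simp only [← map_smul] at this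
      exact this
  ext T
  obtain ⟨t, ht, htT⟩ := mem_closure_iff_seq_limit.1 T.2
  have hlim : Tendsto (fun n => (⟨t n, subset_closure (ht n)⟩ : compactOps A X)) atTop (𝓝 T) :=
    tendsto_subtype_rng.2 htT
  exact tendsto_nhds_unique ((hf.tendsto T).comp hlim)
    (((hg.tendsto T).comp hlim).congr fun n => (hfin _ (ht n) _).symm)

end Compact

/-! ### Existence of the induced representation -/

section Existence

variable {A : Type u} [NonUnitalCStarAlgebra A] [PartialOrder A] [StarOrderedRing A]
  {X : Type v} [NormedAddCommGroup X] [NormedSpace ℂ X] [CompleteSpace X]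
  [SMul Aᵐᵒᵖ X] [CStarModule Aᵐᵒᵖ X]
  {H : Type w} [NormedAddCommGroup H] [InnerProductSpace ℂ H] [CompleteSpace H]
  {E : Type*} [NormedAddCommGroup E] [InnerProductSpace ℂ E] [CompleteSpace E]
  {K : Type z} [NormedAddCommGroup K] [InnerProductSpace ℂ K] [CompleteSpace K]
  {φ : CompletelyPositiveMap A (H →L[ℂ] H)} {Φ : X → (H →L[ℂ] K)}

theorem adjoint_rep_comp (π : A →⋆ₙₐ[ℂ] (E →L[ℂ] E)) (V : H →L[ℂ] E) (a : A) :
    adjoint (π a ∘L V) = adjoint V ∘L π (star a) := by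
  rw [adjoint_comp, map_star, ContinuousLinearMap.star_eq_adjoint]

theorem rep_comp_rep {G : Type*} [NormedAddCommGroup G] [InnerProductSpace ℂ G]
    (π : A →⋆ₙₐ[ℂ] (E →L[ℂ] E)) (a b : A) (T : G →L[ℂ] E) :
    π a ∘L π b ∘L T = π (a * b) ∘L T := by
  rw [map_mul, ContinuousLinearMap.mul_def, ContinuousLinearMap.comp_assoc]

theorem synthesis_comp {S : Type*} (T : E →L[ℂ] K) (v : S → (H →L[ℂ] E)) (f : S →₀ H) :
    synthesis (fun s => T ∘L v s) f = T (synthesis v f) := by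
  simp only [synthesis_apply, map_finsuppSum, ContinuousLinearMap.comp_apply]

/-- A `φ`-map dilates along a minimal Stinespring dilation of `φ`. -/
theorem IsPhiMap.exists_dilation (hΦ : IsPhiMap φ Φ) {π : A →⋆ₙₐ[ℂ] (E →L[ℂ] E)}
    {V : H →L[ℂ] E} (hφ : ∀ a, φ a = adjoint V ∘L π a ∘L V) (hV : IsTotal fun a => π a ∘L V) :
    ∃ Ψ : X → (E →L[ℂ] K), IsPhiMap π Ψ ∧ ∀ x, Φ x = Ψ x ∘L V := by
  -- Ψ(x) is prescribed by Ψ(x)π(a)V = Φ(xa); boundedness comes from ‖Ψ(x)ξ‖² = ⟪ξ, π(⟨x,x⟩)ξ⟫.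
  have hbound : ∀ (x : X) (f : A →₀ H), ‖synthesis (fun a => Φ (x <• a)) f‖ ≤
      ‖x‖ * ‖synthesis (fun a => π a ∘L V) f‖ := fun x f => by
    have h1 : ⟪synthesis (fun a => Φ (x <• a)) f, synthesis (fun a => Φ (x <• a)) f⟫_ℂ =
        ⟪synthesis (fun a => π a ∘L V) f,
          π (rinner A x x) (synthesis (fun a => π a ∘L V) f)⟫_ℂ := by
      rw [← synthesis_comp, inner_synthesis, inner_synthesis]
      simp only [hΦ _ _, hφ, adjoint_rep_comp, ContinuousLinearMap.comp_assoc, rep_comp_rep,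
        rinner_smul_left, rinner_smul_right, mul_assoc]
    refine le_of_sq_le_sq ?_ (by positivity)
    rw [← inner_self_eq_norm_sq (𝕜 := ℂ), h1]
    refine (RCLike.re_le_norm _).trans ((norm_inner_le_norm _ _).trans ?_)
    have h2 : ‖π (rinner A x x)‖ ≤ ‖x‖ ^ 2 :=
      (NonUnitalStarAlgHom.norm_apply_le π _).trans_eq (norm_sq_eq_rinner x).symm
    refine (mul_le_mul_of_nonneg_left ((π (rinner A x x)).le_of_opNorm_le h2 _)
      (norm_nonneg _)).trans_eq ?_
    ring
  choose Ψ hΨ using fun x => hV.exists_extension _ _ (hbound x)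
  have hΨmap : IsPhiMap π Ψ := fun x y => hV.ext fun b => hV.ext_adjoint fun a => by
    have h1 : adjoint (π a ∘L V) ∘L adjoint (Ψ x) = adjoint (Φ (x <• a)) := by
      rw [← adjoint_comp, hΨ]
    rw [ContinuousLinearMap.comp_assoc, hΨ, ← ContinuousLinearMap.comp_assoc, h1, hΦ, hφ,
      adjoint_rep_comp]
    simp only [ContinuousLinearMap.comp_assoc, rep_comp_rep, rinner_smul_left, rinner_smul_right,
      mul_assoc]
  refine ⟨Ψ, hΨmap, fun x => ?_⟩
  obtain ⟨C, hC0, hC⟩ := φ.exists_norm_apply_le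
  -- So far Φ(xe) = Ψ(xe)V for e in A only; the limit along an approximate unit removes e.
  have h1 : Tendsto (fun e : A => Φ (x <• e)) (CStarAlgebra.approximateUnit A) (𝓝 (Φ x)) :=
    ((hΦ.continuous hC0 hC).tendsto x).comp (tendsto_smul_approximateUnit x)
  have h2 : Tendsto (fun e : A => Ψ (x <• e) ∘L V) (CStarAlgebra.approximateUnit A)
      (𝓝 (Ψ x ∘L V)) :=
    (((hΨmap.continuous_of_rep).clm_comp continuous_const).tendsto x).comp
      (tendsto_smul_approximateUnit x)
  refine tendsto_nhds_unique h1 (h2.congr fun e => ?_)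
  rw [hΨmap.map_smul_right, ContinuousLinearMap.comp_assoc, hΨ]

/-- K(X) acts on X itself, and φ(⟨Tx, y⟩) = φ(⟨x, T*y⟩) is the compatibility with the involution. -/
theorem IsPhiMap.exists_rep_compactOps (hΦ : IsPhiMap φ Φ) (htot : IsTotal Φ) :
    ∃ Γ : compactOps A X →⋆ₙₐ[ℂ] (K →L[ℂ] K),
      ∀ (T : compactOps A X) (x : X), Γ T ∘L Φ x = Φ ((T : X →L[ℂ] X) x) := by
  let ρ : compactOps A X →ₗ[ℂ] X →ₗ[ℂ] X :=
    { toFun := fun T => ((T : X →L[ℂ] X) : X →ₗ[ℂ] X)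
      map_add' := fun _ _ => rfl
      map_smul' := fun _ _ => rfl }
  exact exists_rep_of_action hΦ.toLinearMap htot ρ (fun _ _ _ => rfl) fun T x y =>
    (hΦ _ _).trans ((congrArg φ (isAdjointOf_star T x y)).trans (hΦ _ _).symm)

/-- The closed linear span of the ranges of the operators `Φ x`. -/
def essentialRange (Φ : X → (H →L[ℂ] K)) : Submodule ℂ K :=
  (Submodule.span ℂ {η : K | ∃ (x : X) (h : H), η = Φ x h}).topologicalClosure

instance : CompleteSpace (essentialRange Φ) :=
  (Submodule.isClosed_topologicalClosure _).completeSpace_coe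

theorem apply_mem_essentialRange (x : X) (h : H) : Φ x h ∈ essentialRange Φ :=
  subset_closure (Submodule.subset_span ⟨x, h, rfl⟩)

variable (Φ) in
/-- `Φ` with values in its essential range. -/
noncomputable def toEssentialRange (x : X) : H →L[ℂ] essentialRange Φ :=
  (Φ x).codRestrict (essentialRange Φ) (apply_mem_essentialRange x)

theorem subtypeL_comp_toEssentialRange (x : X) :
    (essentialRange Φ).subtypeL ∘L toEssentialRange Φ x = Φ x := rfl

theorem isTotal_toEssentialRange : IsTotal (toEssentialRange Φ) := by
  rw [IsTotal, eq_top_iff]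
  rintro ⟨η, hη⟩ -
  rw [← SetLike.mem_coe, Submodule.topologicalClosure_coe, closure_subtype]
  refine closure_mono ?_ hη
  intro ξ hξ
  induction hξ using Submodule.span_induction with
  | mem ξ h =>
    obtain ⟨x, h, rfl⟩ := h
    exact ⟨toEssentialRange Φ x h, Submodule.subset_span ⟨x, h, rfl⟩, rfl⟩
  | zero => exact ⟨0, zero_mem _, rfl⟩
  | add ξ η _ _ h h' =>
    obtain ⟨a, ha, rfl⟩ := h
    obtain ⟨b, hb, rfl⟩ := h'
    exact ⟨a + b, add_mem ha hb, rfl⟩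
  | smul c ξ _ h =>
    obtain ⟨a, ha, rfl⟩ := h
    exact ⟨c • a, Submodule.smul_mem _ c ha, rfl⟩

theorem IsPhiMap.toEssentialRange (hΦ : IsPhiMap φ Φ) : IsPhiMap φ (toEssentialRange Φ) :=
  fun x y => by
    rw [← hΦ]
    ext1 h
    refine ext_inner_left ℂ fun k => ?_
    rw [ContinuousLinearMap.comp_apply, ContinuousLinearMap.comp_apply, adjoint_inner_right,
      adjoint_inner_right]
    rfl

theorem orthogonalProjectionOnto_comp_subtypeL (M : Submodule ℂ K) [CompleteSpace M] :
    M.orthogonalProjectionOnto ∘L M.subtypeL = ContinuousLinearMap.id ℂ M := by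
  ext x
  simp

/-- The representation `T ↦ W* Γ(T) W` for a coisometry `W`. -/
noncomputable def coisometryConj {B : Type*} [NonUnitalCStarAlgebra B] (Γ : B →⋆ₙₐ[ℂ] (E →L[ℂ] E))
    (W : K →L[ℂ] E) (hW : W ∘L adjoint W = ContinuousLinearMap.id ℂ E) :
    B →⋆ₙₐ[ℂ] (K →L[ℂ] K) where
  toFun T := adjoint W ∘L Γ T ∘L W
  map_smul' c T := by simp [ContinuousLinearMap.smul_comp]
  map_zero' := by simp
  map_add' S T := by simp [ContinuousLinearMap.add_comp, ContinuousLinearMap.comp_add]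
  map_mul' S T := by
    have : W ∘L adjoint W ∘L Γ T ∘L W = Γ T ∘L W := by
      rw [← ContinuousLinearMap.comp_assoc, hW, ContinuousLinearMap.id_comp]
    simp only [map_mul, ContinuousLinearMap.mul_def, ContinuousLinearMap.comp_assoc, this]
  map_star' T := by
    simp only [map_star, ContinuousLinearMap.star_eq_adjoint, adjoint_comp, adjoint_adjoint,
      ContinuousLinearMap.comp_assoc]

/-- K' is the essential range of Φ and W the projection onto it, which makes the right-hand
minimality automatic. -/
theorem IsPhiMap.exists_isInducedRep (hΦ : IsPhiMap φ Φ) :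
    ∃ ϕ : compactOps A X →⋆ₙₐ[ℂ] (K →L[ℂ] K), IsInducedRep φ Φ ϕ := by
  obtain ⟨E, _, _, _, π, V, hφ, hV⟩ := φ.exists_stinespring
  have hΦ' := hΦ.toEssentialRange
  have htot := isTotal_toEssentialRange (Φ := Φ)
  obtain ⟨Ψ, hΨ, hΨV⟩ := hΦ'.exists_dilation hφ hV
  obtain ⟨Γ, hΓ⟩ := hΦ'.exists_rep_compactOps htot
  let W : K →L[ℂ] essentialRange Φ := (essentialRange Φ).orthogonalProjectionOnto
  have hWadj : adjoint W = (essentialRange Φ).subtypeL :=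
    Submodule.adjoint_orthogonalProjectionOnto _
  have hW : W ∘L adjoint W = ContinuousLinearMap.id ℂ _ := by
    rw [hWadj]
    exact orthogonalProjectionOnto_comp_subtypeL _
  refine ⟨coisometryConj Γ W hW, E, inferInstance, inferInstance, inferInstance, essentialRange Φ,
    inferInstance, inferInstance, inferInstance,
    { repA := π
      repX := Ψ
      V := V
      W := W
      repX_isPhiMap := hΨ
      coisometry := hW
      dilation_phi := hφ
      dilation_Phi := fun x => by rw [hWadj, ← hΨV, subtypeL_comp_toEssentialRange]
      minimal_left := hV
      minimal_right := by simpa only [IsTotal, hΨV, ContinuousLinearMap.comp_apply] using htot },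
    Γ, fun x y => htot.ext fun z => ?_, fun _ => rfl⟩
  -- On Φ(z) both sides equal Ψ(x)π(⟨y,z⟩)V = Ψ(x⟨y,z⟩)V.
  rw [hΓ, hΨV, hΨV, ContinuousLinearMap.comp_assoc,
    ← ContinuousLinearMap.comp_assoc (adjoint (Ψ y)), hΨ, ← ContinuousLinearMap.comp_assoc,
    ← hΨ.map_smul_right]
  rfl

end Existence

/-! ### An operator identity for contractions -/

section Operators

variable {H : Type*} [NormedAddCommGroup H] [InnerProductSpace ℂ H] [CompleteSpace H]
  {E : Type*} [NormedAddCommGroup E] [InnerProductSpace ℂ E] [CompleteSpace E]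
  {G : Type*} [NormedAddCommGroup G] [InnerProductSpace ℂ G] [CompleteSpace G]

/-- If `V` is a contraction and `S S* = S V V* S*`, then `S = S V V*`. -/
theorem comp_contraction_eq {V : H →L[ℂ] E} (hV : ‖V‖ ≤ 1) {S : E →L[ℂ] G}
    (h : S ∘L adjoint S = S ∘L V ∘L adjoint V ∘L adjoint S) : S = S ∘L V ∘L adjoint V := by
  have key : adjoint S = V ∘L adjoint V ∘L adjoint S := by
    ext η
    set ξ := adjoint S η with hξ
    have h1 : ‖adjoint V ξ‖ ^ 2 = ‖ξ‖ ^ 2 := by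
      have h2 := congrArg (fun T : G →L[ℂ] G => (⟪η, T η⟫_ℂ).re) h
      simp only [ContinuousLinearMap.comp_apply] at h2
      rw [← adjoint_inner_left, ← adjoint_inner_left S, ← adjoint_inner_left V, ← hξ] at h2
      rw [← inner_self_eq_norm_sq (𝕜 := ℂ), ← inner_self_eq_norm_sq (𝕜 := ℂ)]
      exact h2.symm
    have h3 : ‖V (adjoint V ξ)‖ ≤ ‖adjoint V ξ‖ := by
      simpa using V.le_of_opNorm_le hV (adjoint V ξ)
    -- The square expands to ‖ξ‖² - 2‖V*ξ‖² + ‖VV*ξ‖², where ‖V*ξ‖ = ‖ξ‖ and ‖VV*ξ‖ ≤ ‖V*ξ‖.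
    have h4 : ‖ξ - V (adjoint V ξ)‖ ^ 2 ≤ 0 := by
      rw [norm_sub_sq (𝕜 := ℂ), ← adjoint_inner_left, inner_self_eq_norm_sq]
      nlinarith [norm_nonneg (V (adjoint V ξ))]
    simpa [sub_eq_zero] using h4
  have := congrArg adjoint key
  simpa only [adjoint_comp, adjoint_adjoint, ContinuousLinearMap.comp_assoc] using this

end Operators

/-! ### Consequences of a minimal dilation -/

namespace MinimalStinespring

variable {A : Type u} [NonUnitalCStarAlgebra A] [PartialOrder A] [StarOrderedRing A]
  {X : Type v} [NormedAddCommGroup X] [NormedSpace ℂ X] [CompleteSpace X]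
  [SMul Aᵐᵒᵖ X] [CStarModule Aᵐᵒᵖ X]
  {H : Type w} [NormedAddCommGroup H] [InnerProductSpace ℂ H] [CompleteSpace H]
  {K : Type z} [NormedAddCommGroup K] [InnerProductSpace ℂ K] [CompleteSpace K]
  {φ : A → (H →L[ℂ] H)} {Φ : X → (H →L[ℂ] K)}
  {H' : Type*} [NormedAddCommGroup H'] [InnerProductSpace ℂ H'] [CompleteSpace H']
  {K' : Type*} [NormedAddCommGroup K'] [InnerProductSpace ℂ K'] [CompleteSpace K']
  (R : MinimalStinespring φ Φ H' K')

theorem isTotal_left : IsTotal fun a => R.repA a ∘L R.V := R.minimal_left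

theorem isTotal_right : IsTotal fun x => R.repX x ∘L R.V := R.minimal_right

theorem W_comp_adjoint_comp {G : Type*} [NormedAddCommGroup G] [InnerProductSpace ℂ G]
    (T : G →L[ℂ] K') : R.W ∘L adjoint R.W ∘L T = T := by
  rw [← ContinuousLinearMap.comp_assoc, R.coisometry, ContinuousLinearMap.id_comp]

theorem adjoint_W_comp_injective {G : Type*} [NormedAddCommGroup G] [InnerProductSpace ℂ G]
    {T T' : G →L[ℂ] K'} (h : adjoint R.W ∘L T = adjoint R.W ∘L T') : T = T' := by
  rw [← R.W_comp_adjoint_comp T, h, R.W_comp_adjoint_comp]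

theorem adjoint_Phi (x : X) : adjoint (Φ x) = adjoint R.V ∘L adjoint (R.repX x) ∘L R.W := by
  rw [R.dilation_Phi, adjoint_comp, adjoint_comp, adjoint_adjoint, ContinuousLinearMap.comp_assoc]

theorem mem_moduleDomain_iff (x : X) :
    x ∈ moduleDomain φ Φ ↔ R.repX x = R.repX x ∘L R.V ∘L adjoint R.V := by
  have h1 : ∀ b, Φ (x <• b) = adjoint R.W ∘L R.repX x ∘L R.repA b ∘L R.V := fun b => by
    rw [R.dilation_Phi, R.repX_isPhiMap.map_smul_right, ContinuousLinearMap.comp_assoc]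
  have h2 : ∀ b, Φ x ∘L φ b =
      adjoint R.W ∘L (R.repX x ∘L R.V ∘L adjoint R.V) ∘L R.repA b ∘L R.V := fun b => by
    rw [R.dilation_Phi, R.dilation_phi]
    simp only [ContinuousLinearMap.comp_assoc]
  constructor
  · intro hx
    refine R.isTotal_left.ext fun b => R.adjoint_W_comp_injective ?_
    rw [← h1, ← h2]
    exact hx b
  · intro hx b
    rw [h1, h2, ← hx]

/-- Tested against the total family π(b)V, multiplicativity gives π(a)V = Vφ(a), and the ternary
identity gives π(a)* = Vφ(a)*V*. Together they yield π(a) = π(a)VV*. -/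
theorem comp_adjoint_V_of_mem_ternaryIdeal {a : A} (ha : a ∈ ternaryIdeal φ) :
    R.repA a ∘L R.V = R.V ∘L φ a ∧ R.repA a = R.repA a ∘L R.V ∘L adjoint R.V := by
  have h1 : R.repA a ∘L R.V = R.V ∘L φ a := R.isTotal_left.ext_adjoint fun b => by
    have := (ha.1 (star b)).2
    rw [R.dilation_phi, R.dilation_phi (star b)] at this
    rw [adjoint_rep_comp, ContinuousLinearMap.comp_assoc, rep_comp_rep, this]
    simp only [ContinuousLinearMap.mul_def, ContinuousLinearMap.comp_assoc]
  have h2 : adjoint (R.repA a) = R.V ∘L star (φ a) ∘L adjoint R.V :=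
    R.isTotal_left.ext fun c => R.isTotal_left.ext_adjoint fun b => by
      have := ha.2 (star b) c
      rw [R.dilation_phi, R.dilation_phi (star b), R.dilation_phi c] at this
      rw [adjoint_rep_comp, ← ContinuousLinearMap.star_eq_adjoint, ← map_star]
      simp only [ContinuousLinearMap.comp_assoc, rep_comp_rep, ContinuousLinearMap.mul_def,
        mul_assoc] at this ⊢
      exact this
  refine ⟨h1, ?_⟩
  rw [← ContinuousLinearMap.comp_assoc, h1]
  have := congrArg adjoint h2
  simpa only [adjoint_comp, adjoint_adjoint, ContinuousLinearMap.star_eq_adjoint] using this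

/-- V*V = φ(1) is not available. Instead ‖V*π(e)‖² = ‖φ(ee*)‖ ≤ 1 for ‖e‖ ≤ 1, and V*π(e)ξ → V*ξ on
the dense span of π(A)VH. -/
theorem norm_V_le_one (hφ : ∀ a, ‖φ a‖ ≤ ‖a‖) : ‖R.V‖ ≤ 1 := by
  rw [← LinearIsometryEquiv.norm_map adjoint]
  refine ContinuousLinearMap.opNorm_le_bound _ zero_le_one fun ξ => ?_
  rw [one_mul]
  have hl := CStarAlgebra.increasingApproximateUnit A
  have hbound : ∀ e : A, ‖e‖ ≤ 1 → ‖adjoint R.V ∘L R.repA e‖ ≤ 1 := fun e he => by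
    rw [← star_star e, ← adjoint_rep_comp, LinearIsometryEquiv.norm_map]
    have h1 : ‖R.repA (star e) ∘L R.V‖ * ‖R.repA (star e) ∘L R.V‖ ≤ 1 * 1 := by
      rw [← norm_adjoint_comp_self, adjoint_rep_comp, ContinuousLinearMap.comp_assoc, rep_comp_rep,
        ← R.dilation_phi]
      refine (hφ _).trans ((norm_mul_le _ _).trans ?_)
      rw [star_star, norm_star]
      gcongr
    exact le_of_not_gt fun h => (mul_self_lt_mul_self zero_le_one h).not_ge h1
  refine R.isTotal_left.denseRange.induction_on (p := fun ξ => ‖adjoint R.V ξ‖ ≤ ‖ξ‖) ξ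
    (isClosed_le (by fun_prop) (by fun_prop)) fun f => ?_
  have hlim : Tendsto
      (fun e => synthesis (fun a => (adjoint R.V ∘L R.repA e) ∘L R.repA a ∘L R.V) f)
      (CStarAlgebra.approximateUnit A)
      (𝓝 (synthesis (fun a => adjoint R.V ∘L R.repA a ∘L R.V) f)) := by
    refine tendsto_finsetSum _ fun a _ => ?_
    have hc : Continuous fun b : A => (adjoint R.V ∘L R.repA b ∘L R.V) (f a) := by
      have : Continuous R.repA := map_continuous R.repA
      fun_prop
    refine ((hc.tendsto a).comp (hl.tendsto_mul_right a)).congr fun e => ?_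
    simp [ContinuousLinearMap.mul_def]
  rw [← synthesis_comp]
  refine le_of_tendsto hlim.norm ?_
  filter_upwards [hl.eventually_norm] with e he
  rw [synthesis_comp]
  simpa using ContinuousLinearMap.le_of_opNorm_le _ (hbound e he) _

section Induced

variable {Γ : compactOps A X →⋆ₙₐ[ℂ] (K' →L[ℂ] K')}
  {ϕ : compactOps A X →⋆ₙₐ[ℂ] (K →L[ℂ] K)}

theorem rep_comp_repX (hΓ : ∀ x y : X, Γ (thetaK A x y) = R.repX x ∘L adjoint (R.repX y))
    (T : compactOps A X) (z : X) : Γ T ∘L R.repX z = R.repX ((T : X →L[ℂ] X) z) := by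
  let f : compactOps A X →ₗ[ℂ] (H' →L[ℂ] K') :=
    { toFun := fun T => Γ T ∘L R.repX z
      map_add' := fun S T => by rw [map_add, ContinuousLinearMap.add_comp]
      map_smul' := fun c T => by rw [map_smul, ContinuousLinearMap.smul_comp]; rfl }
  let g : compactOps A X →ₗ[ℂ] (H' →L[ℂ] K') :=
    { toFun := fun T => R.repX ((T : X →L[ℂ] X) z)
      map_add' := fun S T => R.repX_isPhiMap.map_add _ _
      map_smul' := fun c T => R.repX_isPhiMap.map_smul _ _ }
  have hf : Continuous f := by
    have : Continuous Γ := AddMonoidHomClass.continuous_of_bound Γ 1 fun T => by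
      rw [one_mul]
      exact NonUnitalStarAlgHom.norm_apply_le Γ T
    exact this.clm_comp continuous_const
  have hg : Continuous g := R.repX_isPhiMap.continuous_of_rep.comp
    ((ContinuousLinearMap.apply ℂ X z).continuous.comp continuous_subtype_val)
  refine DFunLike.congr_fun (compactOps_linearMap_ext hf hg fun x y => ?_) T
  change Γ (thetaK A x y) ∘L R.repX z = R.repX (x <• rinner A y z)
  rw [hΓ, ContinuousLinearMap.comp_assoc, R.repX_isPhiMap, R.repX_isPhiMap.map_smul_right]

variable (hΓ : ∀ x y : X, Γ (thetaK A x y) = R.repX x ∘L adjoint (R.repX y))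
  (hϕ : ∀ T : compactOps A X, ϕ T = adjoint R.W ∘L Γ T ∘L R.W)
include hΓ hϕ

theorem induced_comp (T : compactOps A X) (z : X) : ϕ T ∘L Φ z = Φ ((T : X →L[ℂ] X) z) := by
  rw [hϕ, R.dilation_Phi, R.dilation_Phi, ← R.rep_comp_repX hΓ]
  simp only [ContinuousLinearMap.comp_assoc, R.W_comp_adjoint_comp]

theorem induced_theta (x y : X) :
    ϕ (thetaK A x y) = adjoint R.W ∘L R.repX x ∘L adjoint (R.repX y) ∘L R.W := by
  rw [hϕ, hΓ, ContinuousLinearMap.comp_assoc]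

theorem induced_theta_of_mem {x : X} (hx : x ∈ moduleDomain φ Φ) (y : X) :
    ϕ (thetaK A x y) = Φ x ∘L adjoint (Φ y) := by
  rw [R.induced_theta hΓ hϕ, (R.mem_moduleDomain_iff x).1 hx, R.adjoint_Phi, R.dilation_Phi]
  simp only [ContinuousLinearMap.comp_assoc]

theorem mem_of_induced_theta (hφ : ∀ a, ‖φ a‖ ≤ ‖a‖) {x : X}
    (hx : ϕ (thetaK A x x) = Φ x ∘L adjoint (Φ x)) : x ∈ moduleDomain φ Φ := by
  rw [R.mem_moduleDomain_iff]
  refine comp_contraction_eq (R.norm_V_le_one hφ) ?_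
  rw [R.induced_theta hΓ hϕ, R.adjoint_Phi, R.dilation_Phi] at hx
  simp only [ContinuousLinearMap.comp_assoc] at hx
  -- W* is cancelled on the left by injectivity, and W on the right by WW* = 1.
  have h1 := congrArg (· ∘L adjoint R.W) (R.adjoint_W_comp_injective hx)
  simpa only [ContinuousLinearMap.comp_assoc, R.coisometry, ContinuousLinearMap.comp_id] using h1

/-- ⟪Π(x)Vh, Wη⟫ = ⟪Φ(x)h, η⟫ = 0, so Wη = 0 by minimality. -/
theorem induced_apply_of_mem_orthogonal (T : compactOps A X) {η : K}
    (hη : η ∈ (essentialRange Φ)ᗮ) : ϕ T η = 0 := by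
  have hW : R.W η = 0 := by
    refine R.isTotal_right.denseRange.eq_zero_of_inner_right ℂ fun ξ => ?_
    rw [synthesis_apply, Finsupp.sum_inner]
    refine Finset.sum_eq_zero fun x _ => ?_
    change ⟪R.repX x (R.V (ξ x)), R.W η⟫_ℂ = 0
    rw [← adjoint_inner_left]
    refine (Submodule.mem_orthogonal _ _).1 hη _ ?_
    have := apply_mem_essentialRange (Φ := Φ) x (ξ x)
    rwa [R.dilation_Phi] at this
  rw [hϕ, ContinuousLinearMap.comp_apply, ContinuousLinearMap.comp_apply, hW, map_zero, map_zero]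

end Induced

end MinimalStinespring

/-! ### Uniqueness of the induced representation -/

section Uniqueness

variable {A : Type u} [NonUnitalCStarAlgebra A] [PartialOrder A] [StarOrderedRing A]
  {X : Type v} [NormedAddCommGroup X] [NormedSpace ℂ X] [CompleteSpace X]
  [SMul Aᵐᵒᵖ X] [CStarModule Aᵐᵒᵖ X]
  {H : Type w} [NormedAddCommGroup H] [InnerProductSpace ℂ H] [CompleteSpace H]
  {K : Type z} [NormedAddCommGroup K] [InnerProductSpace ℂ K] [CompleteSpace K]
  {φ : A → (H →L[ℂ] H)} {Φ : X → (H →L[ℂ] K)}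

theorem eq_of_eq_on_essentialRange {T T' : K →L[ℂ] K} (h : ∀ x, T ∘L Φ x = T' ∘L Φ x)
    (h' : ∀ η ∈ (essentialRange Φ)ᗮ, T η = T' η) : T = T' := by
  have hle : essentialRange Φ ≤ LinearMap.ker ((T - T' : K →L[ℂ] K) : K →ₗ[ℂ] K) := by
    refine Submodule.topologicalClosure_minimal _ (Submodule.span_le.2 ?_)
      (T - T').isClosed_ker
    rintro _ ⟨x, k, rfl⟩
    simpa [sub_eq_zero] using DFunLike.congr_fun (h x) k
  have hle' : (essentialRange Φ)ᗮ ≤ LinearMap.ker ((T - T' : K →L[ℂ] K) : K →ₗ[ℂ] K) :=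
    fun η hη => by simpa [sub_eq_zero] using h' η hη
  ext η
  have hη := sup_le hle hle'
    (Submodule.sup_orthogonal_of_hasOrthogonalProjection (K := essentialRange Φ) ▸
      Submodule.mem_top (x := η))
  simpa [sub_eq_zero] using hη

/-- The values of ϕ(T) on the essential range and on its complement are described by Φ alone, so the
dilation drops out. -/
theorem IsInducedRep.unique {ϕ ϕ' : compactOps A X →⋆ₙₐ[ℂ] (K →L[ℂ] K)}
    (h : IsInducedRep φ Φ ϕ) (h' : IsInducedRep φ Φ ϕ') : ϕ = ϕ' := by
  obtain ⟨_, _, _, _, _, _, _, _, R, Γ, hΓ, hϕ⟩ := h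
  obtain ⟨_, _, _, _, _, _, _, _, R', Γ', hΓ', hϕ'⟩ := h'
  refine NonUnitalStarAlgHom.ext fun T => eq_of_eq_on_essentialRange (Φ := Φ)
    (fun z => ?_) fun η hη => ?_
  · rw [R.induced_comp hΓ hϕ, R'.induced_comp hΓ' hϕ']
  · rw [R.induced_apply_of_mem_orthogonal hΓ hϕ T hη,
      R'.induced_apply_of_mem_orthogonal hΓ' hϕ' T hη]

end Uniqueness

end TernaryDomain

theorem mainTheorem10
    {A : Type*} [NonUnitalCStarAlgebra A] [PartialOrder A] [StarOrderedRing A]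
    {X : Type*} [NormedAddCommGroup X] [NormedSpace ℂ X] [CompleteSpace X]
    [SMul Aᵐᵒᵖ X] [CStarModule Aᵐᵒᵖ X]
    {H : Type*} [NormedAddCommGroup H] [InnerProductSpace ℂ H] [CompleteSpace H]
    {K : Type*} [NormedAddCommGroup K] [InnerProductSpace ℂ K] [CompleteSpace K]
    (φ : CompletelyPositiveMap A (H →L[ℂ] H)) (Φ : X → (H →L[ℂ] K))
    (hΦ : TernaryDomain.IsPhiMap φ Φ) :
    -- the `φ`-module domain is the same for all `φ`-maps, so that it is the set `X_φ`
    (∀ (K₂ : Type*) [NormedAddCommGroup K₂] [InnerProductSpace ℂ K₂] [CompleteSpace K₂]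
      (Ψ : X → (H →L[ℂ] K₂)), TernaryDomain.IsPhiMap φ Ψ →
        TernaryDomain.moduleDomain φ Ψ = TernaryDomain.moduleDomain φ Φ) ∧
    -- the representation `ϕ_{Φ,φ}` is well defined
    (∃! ϕ : HilbertModule.compactOps A X →⋆ₙₐ[ℂ] (K →L[ℂ] K),
      TernaryDomain.IsInducedRep φ Φ ϕ) ∧
    ∀ ϕ : HilbertModule.compactOps A X →⋆ₙₐ[ℂ] (K →L[ℂ] K), TernaryDomain.IsInducedRep φ Φ ϕ →
      (∀ (T : HilbertModule.compactOps A X) (z : X),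
        Φ ((T : X →L[ℂ] X) z) = ϕ T ∘L Φ z) ∧
      (∀ (T : HilbertModule.compactOps A X) (z : X), z ∈ TernaryDomain.moduleDomain φ Φ →
        (T : X →L[ℂ] X) z ∈ TernaryDomain.moduleDomain φ Φ) ∧
      ((∀ a : A, ‖φ a‖ ≤ ‖a‖) →
        (∀ x : X, x ∈ TernaryDomain.moduleDomain φ Φ ↔
          ϕ (HilbertModule.thetaK A x x) = Φ x ∘L ContinuousLinearMap.adjoint (Φ x)) ∧
        (∀ x : X, x ∈ TernaryDomain.moduleDomain φ Φ ↔
          ∀ y : X, ϕ (HilbertModule.thetaK A x y) =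
            Φ x ∘L ContinuousLinearMap.adjoint (Φ y))) ∧
      (∀ (x y : X) (a : A), a ∈ TernaryDomain.ternaryIdeal φ →
        ϕ (HilbertModule.thetaK A (x <• a) y) =
            Φ (x <• a) ∘L ContinuousLinearMap.adjoint (Φ y) ∧
          Φ (x <• a) ∘L ContinuousLinearMap.adjoint (Φ y) =
            Φ x ∘L φ a ∘L ContinuousLinearMap.adjoint (Φ y)) := by
  refine ⟨fun K₂ _ _ _ Ψ hΨ => ?_, ?_, fun ϕ hϕ => ?_⟩
  · ext x
    rw [hΨ.mem_moduleDomain_iff, hΦ.mem_moduleDomain_iff]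
  · obtain ⟨ϕ, hϕ⟩ := hΦ.exists_isInducedRep
    exact ⟨ϕ, hϕ, fun ϕ' hϕ' => hϕ'.unique hϕ⟩
  obtain ⟨H', _, _, _, K', _, _, _, R, Γ, hΓ, hϕ⟩ := hϕ
  have hcomp := R.induced_comp hΓ hϕ
  refine ⟨fun T z => (hcomp T z).symm, fun T z hz b => ?_, fun hφ => ⟨fun x => ?_, fun x => ?_⟩,
    fun x y a ha => ?_⟩
  -- Φ((Tz)b) = Φ(T(zb)) = ϕ(T)Φ(z)φ(b) = Φ(Tz)φ(b).
  · rw [← TernaryDomain.compactOps_smul_right, ← hcomp, ← hcomp, hz b,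
      ContinuousLinearMap.comp_assoc]
  · exact ⟨fun hx => R.induced_theta_of_mem hΓ hϕ hx x, R.mem_of_induced_theta hΓ hϕ hφ⟩
  · exact ⟨fun hx y => R.induced_theta_of_mem hΓ hϕ hx y,
      fun hx => R.mem_of_induced_theta hΓ hϕ hφ (hx x)⟩
  · obtain ⟨h1, h2⟩ := R.comp_adjoint_V_of_mem_ternaryIdeal ha
    have hX := R.repX_isPhiMap.map_smul_right x a
    -- Π(xa) = Π(x)π(a) and π(a) = π(a)VV* put xa in X_φ.
    refine ⟨R.induced_theta_of_mem hΓ hϕ ((R.mem_moduleDomain_iff _).2 ?_) y, ?_⟩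
    · rw [hX, ContinuousLinearMap.comp_assoc, ← h2]
    · rw [R.dilation_Phi (x <• a), hX, ContinuousLinearMap.comp_assoc (R.repX x), h1,
        R.dilation_Phi x]
      simp only [ContinuousLinearMap.comp_assoc]
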